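/- All graphs are finite, simple and undirected. For a graph $G$ on at least one vertex, $\delta(G)$ denotes its minimum degree, and its connectivity $\kappa(G)$ is the minimum number of vertices in a proper subset $S\subsetneq V(G)$ such that $G-S$ is disconnected or consists of a single vertex. Let $\ell\ge 1$ be an integer and let $G$ be a graph with $n$ vertices, $\delta(G)\ge \frac n2$ and $$n\ \ge\ \max\left\{\,2\kappa(G)\ell+\kappa(G)-2\ell+1,\ \ 6\kappa(G)+8\ell-4-2\left\lceil\frac{\kappa(G)-2}{\kappa(G)}\right\rceil\right\}.$$ (Since $\delta(G)\ge \frac n2$ forces $G$ to be connected with at least two vertices, $\kappa(G)\ge 1$ and the bound is well defined.) Then $G$ contains $\ell$ pairwise edge-disjoint Hamiltonian cycles $H_1,H_2,\dots,H_\ell$ such that $$\kappa\Big(G-\bigcup_{1\le i\le \ell}E(H_i)\Big)=\kappa(G),$$ where the graph on the left has the same vertex set as $G$ and only the edges of the cycles are removed. -/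

import Mathlib

/-- The (vertex) connectivity `κ(G)` of a finite simple graph: the least number of vertices in a
proper subset `S` of the vertex set such that `G - S` is disconnected or is a single vertex.
In particular `κ(K_n) = n - 1` for `n ≥ 1`, and `κ(G) = 0` if `G` is disconnected. -/
noncomputable def SimpleGraph.vertexConnectivity {V : Type*} [Fintype V] (G : SimpleGraph V) : ℕ :=
  sInf {k : ℕ | ∃ S : Finset V, S.card = k ∧ S ≠ Finset.univ ∧
    (¬ (G.induce {v : V | v ∉ S}).Connected ∨ S.card + 1 = Fintype.card V)}

/-! Take a minimum separator `S`, with `k = |S|`, splitting the rest into `A` and `B`, and let `d =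
δ(G)`. Vertices of `A` have neighbours only in `A ∪ S`, so `|A| = d + 1 - k + y` with `y ≥ 0`, and
similarly `|B| = d + 1 - k + x`. Since `n ≤ 2d`, `x + y + 2 ≤ k`. A vertex of `A` thus misses at
most `y` other vertices of `A ∪ S`, so `A` and, symmetrically, `B` are nearly complete and nearly
joined to `S`.

By Hall's theorem and minimality, `S` can be matched into `A` and into `B`. These matchings are set
aside and all cycles avoid them. Afterwards they force connectivity at least `k`: a smaller set
misses some `s` with both its partners, and `s` then ties together what is left of `A` and `B`
(`IsSeparation.card_le_of_matching`).

Each cycle crosses from `A` to `B` through two vertices of `S` and is closed by a spanning path on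
each side, found by a degree-closure argument (`exists_isSpanningPath`). Let `T` be the part of `S`
with at least as many neighbours in `B` as in `A`, and `U` the rest; the paths absorb `T` in `B` and
`U` in `A`. The scarce minority edges `T`–`A` and `U`–`B` serve only as crossings, at four or fewer
vertices per cycle, so untouched ones remain for every round (`IsDenseSplit.exists_step`). -/

namespace List

/-! ### Splitting, counting and block reversal in lists. -/

variable {α : Type*}

theorem exists_split_of_not_isChain {R : α → α → Prop} {l : List α} (h : ¬ l.IsChain R) :
    ∃ X p q Y, l = X ++ p :: q :: Y ∧ ¬ R p q := by
  induction l with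
  | nil => simp at h
  | cons x l ih =>
    cases l with
    | nil => simp at h
    | cons y l =>
      by_cases hxy : R x y
      · obtain ⟨X, p, q, Y, e, hR⟩ := ih (fun hc => h (isChain_cons_cons.2 ⟨hxy, hc⟩))
        exact ⟨x :: X, p, q, Y, by simp [e], hR⟩
      · exact ⟨[], x, y, l, rfl, hxy⟩

/-- Each consecutive pair `p, q` contributes at most one to `P p + Q q`; the last entry adds one
more through `P` alone. -/
theorem countP_add_countP_le_of_isChain (P Q : α → Bool) (x : α) (l : List α)
    (h : (x :: l).IsChain fun p q => ¬ (P p ∧ Q q)) :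
    (x :: l).countP P + l.countP Q ≤ l.length + 1 := by
  induction l generalizing x with
  | nil => simpa using countP_le_length (p := P) (l := [x])
  | cons y l ih =>
    rw [isChain_cons_cons] at h
    have := ih y h.2
    rw [countP_cons (l := y :: l), countP_cons (p := Q), length_cons]
    have h1 := h.1
    split_ifs <;> first | omega | exact absurd ⟨‹_›, ‹_›⟩ h1

theorem isChain_append_reverse_append {R : α → α → Prop} (hR : ∀ a b, R a b → R b a) {X Z Y : List α} {p q u v : α}
    (hX : (X ++ [p]).IsChain R) (hZ : (q :: Z).IsChain R) (hY : (v :: Y).IsChain R)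
    (hu : (q :: Z).getLast? = some u) (hpu : R p u) (hqv : R q v) :
    ((X ++ [p]) ++ (q :: Z).reverse ++ v :: Y).IsChain R := by
  have hZ' : (q :: Z).reverse.IsChain R := by
    rw [isChain_reverse]
    exact hZ.imp hR
  refine isChain_append.2 ⟨isChain_append.2 ⟨hX, hZ', ?_⟩, hY, ?_⟩
  · intro a ha b hb
    simp at ha
    rw [head?_reverse, hu] at hb
    simp at hb
    subst ha hb
    exact hpu
  · intro a ha b hb
    rw [getLast?_append_of_ne_nil _ (by simp)] at ha
    simp at ha hb
    subst ha hb
    exact hqv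

end List

/-! ### Spanning paths with prescribed ends, and gluing them into a cycle. -/

namespace SimpleGraph

variable {V : Type*}

open Classical in
/-- The neighbours of `v` in `G` that lie in `W`. -/
noncomputable def nbrs (G : SimpleGraph V) (W : Finset V) (v : V) : Finset V :=
  {w ∈ W | G.Adj v w}

theorem mem_nbrs {G : SimpleGraph V} {W : Finset V} {v w : V} :
    w ∈ G.nbrs W v ↔ w ∈ W ∧ G.Adj v w := by
  simp [nbrs]

theorem nbrs_subset {G : SimpleGraph V} {W : Finset V} {v : V} : G.nbrs W v ⊆ W :=
  fun _ h => (mem_nbrs.1 h).1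

theorem card_nbrs_mono {G H : SimpleGraph V} (h : G ≤ H) {W W' : Finset V} (hW : W ⊆ W') (v : V) :
    (G.nbrs W v).card ≤ (H.nbrs W' v).card :=
  Finset.card_le_card fun _ hw => mem_nbrs.2 ⟨hW (mem_nbrs.1 hw).1, h (mem_nbrs.1 hw).2⟩

/-- The list `l` is a path of `G` from `a` to `b` with vertex set `W`. -/
structure IsSpanningPath (G : SimpleGraph V) (W : Finset V) (a b : V) (l : List V) : Prop where
  nodup : l.Nodup
  mem_iff : ∀ v, v ∈ l ↔ v ∈ W
  isChain : l.IsChain G.Adj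
  head : l.head? = some a
  last : l.getLast? = some b

variable {G K : SimpleGraph V} {W : Finset V} {a b : V} {l : List V}

theorem IsSpanningPath.length_eq (h : G.IsSpanningPath W a b l) : l.length = W.card := by
  classical
  rw [← List.toFinset_card_of_nodup h.nodup]
  congr 1
  ext v
  simp [h.mem_iff]

theorem IsSpanningPath.card_nbrs_eq (h : G.IsSpanningPath W a b l) (K : SimpleGraph V)
    [DecidableRel K.Adj] (v : V) : (K.nbrs W v).card = l.countP (fun w => K.Adj v w) := by
  classical
  rw [List.countP_eq_length_filter, ← List.toFinset_card_of_nodup (h.nodup.filter _)]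
  congr 1
  ext w
  simp [h.mem_iff, mem_nbrs]

/-- Bondy–Chvátal closure for paths with fixed ends. If a path uses the new edge, the degree sum
forces a block next to that edge whose reversal replaces it by edges of `K`. -/
theorem exists_isSpanningPath_of_sup_edge {u v : V} (huv : ¬ K.Adj u v)
    (hdeg : W.card + 1 ≤ (K.nbrs W u).card + (K.nbrs W v).card)
    (h : ∃ l, (K ⊔ edge u v).IsSpanningPath W a b l) : ∃ l, K.IsSpanningPath W a b l := by
  classical
  obtain ⟨l, hl⟩ := h
  by_contra hno
  have hsplit : ∃ X p q Y, l = X ++ p :: q :: Y ∧ ¬ K.Adj p q := by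
    apply List.exists_split_of_not_isChain
    exact fun hc => hno ⟨l, hl.nodup, hl.mem_iff, hc, hl.head, hl.last⟩
  obtain ⟨X, u', v', Y, rfl, hK⟩ := hsplit
  have hadj : (K ⊔ edge u v).Adj u' v' :=
    (List.isChain_append.1 hl.isChain).2.1.rel
  -- The new edge may be traversed in either direction; from here it runs from `u'` to `v'`.
  have huv' : ¬ K.Adj u' v' ∧ (∀ p q, (K ⊔ edge u v).Adj p q → ¬ K.Adj p q →
      (p = u' ∧ q = v') ∨ (p = v' ∧ q = u')) ∧
      W.card + 1 ≤ (K.nbrs W u').card + (K.nbrs W v').card := by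
    refine ⟨hK, ?_⟩
    rw [sup_adj, edge_adj] at hadj
    rcases (hadj.resolve_left hK).1 with ⟨rfl, rfl⟩ | ⟨rfl, rfl⟩
    · refine ⟨fun p q h h' => ?_, hdeg⟩
      rw [sup_adj, edge_adj] at h
      tauto
    · refine ⟨fun p q h h' => ?_, by omega⟩
      rw [sup_adj, edge_adj] at h
      tauto
  clear huv hdeg hadj
  obtain ⟨huv, hnew, hdeg⟩ := huv'
  generalize u' = u1, v' = v1 at *
  have hnd := hl.nodup
  have hchain := hl.isChain
  have hX : (X ++ [u1]).IsChain K.Adj := by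
    rw [← List.singleton_append, ← List.append_assoc] at hchain
    refine (List.isChain_append.1 hchain).1.imp_of_mem_imp fun p q hp hq h => ?_
    by_contra h'
    have : v1 ∉ X ++ [u1] := by
      intro hv
      simp only [List.nodup_append, List.nodup_cons] at hnd
      simp at hv hnd
      grind
    rcases hnew p q h h' with ⟨rfl, rfl⟩ | ⟨rfl, rfl⟩ <;> contradiction
  have hY : (v1 :: Y).IsChain K.Adj := by
    refine (List.isChain_append.1 hchain).2.1.tail.imp_of_mem_imp fun p q hp hq h => ?_
    by_contra h'
    have : u1 ∉ v1 :: Y := by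
      intro hv
      simp only [List.nodup_append, List.nodup_cons] at hnd
      grind
    rcases hnew p q h h' with ⟨rfl, rfl⟩ | ⟨rfl, rfl⟩ <;> contradiction
  -- Nonempty outer blocks keep both ends of the path fixed under the reversal.
  have finish : ∀ L Z R : List V, L ≠ [] → R ≠ [] → X ++ u1 :: v1 :: Y = L ++ Z ++ R →
      (L ++ Z.reverse ++ R).IsChain K.Adj → False := by
    intro L Z R hL hR e hc
    rw [e] at hl
    have hperm : (L ++ Z.reverse ++ R).Perm (L ++ Z ++ R) :=
      ((List.Perm.refl L).append (List.reverse_perm Z)).append_right R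
    refine hno ⟨L ++ Z.reverse ++ R, hperm.nodup_iff.2 hl.nodup, fun w => ?_, hc, ?_, ?_⟩
    · rw [hperm.mem_iff, hl.mem_iff]
    · rw [← hl.head]
      cases L with
      | nil => contradiction
      | cons => simp
    · rw [← hl.last, List.getLast?_append_of_ne_nil _ hR, List.getLast?_append_of_ne_nil _ hR]
  -- Consecutive `p, q` before the new edge with `u1 ~ p` and `v1 ~ q` would permit reversing the
  -- block from `q` to `u1`. The list is reversed so that `u1` heads it.
  have hc1 : ((X ++ [u1]).reverse).IsChain
      fun p q => ¬ (decide (K.Adj v1 p) = true ∧ decide (K.Adj u1 q) = true) := by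
    rw [List.isChain_reverse]
    by_contra hn
    obtain ⟨X1, p, q, X2, e, h⟩ := List.exists_split_of_not_isChain hn
    simp only [decide_eq_true_eq, not_not] at h
    refine finish (X1 ++ [p]) (q :: X2) (v1 :: Y) (by simp) (by simp) ?_ ?_
    · rw [← List.singleton_append, ← List.append_assoc, e]
      simp
    · have e' : X ++ [u1] = (X1 ++ [p]) ++ (q :: X2) := by simp [e]
      rw [e'] at hX
      have hX' := List.isChain_append.1 hX
      refine List.isChain_append_reverse_append (fun _ _ h => h.symm) (u := u1) hX'.1 hX'.2.1 hY ?_ h.2.symm h.1.symm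
      rw [← List.getLast?_append_of_ne_nil (X1 ++ [p]) (by simp), ← e']
      simp
  have hc2 : (v1 :: Y).IsChain
      fun p q => ¬ (decide (K.Adj u1 p) = true ∧ decide (K.Adj v1 q) = true) := by
    by_contra hn
    obtain ⟨Y1, p, q, Y2, e, h⟩ := List.exists_split_of_not_isChain hn
    simp only [decide_eq_true_eq, not_not] at h
    refine finish (X ++ [u1]) (Y1 ++ [p]) (q :: Y2) (by simp) (by simp) ?_ ?_
    · rw [e]
      simp
    · have e' : v1 :: Y = (Y1 ++ [p]) ++ (q :: Y2) := by simp [e]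
      rw [e'] at hY
      have hY' := List.isChain_append.1 hY
      cases Y1 with
      | nil =>
        simp only [List.nil_append, List.cons_append, List.cons.injEq] at e'
        obtain ⟨rfl, -⟩ := e'
        exact absurd h.1.symm (fun h' => huv h'.symm)
      | cons y Y1 =>
        simp only [List.cons_append, List.cons.injEq] at e'
        obtain ⟨rfl, -⟩ := e'
        refine List.isChain_append_reverse_append (fun _ _ h => h.symm) (u := p) hX hY'.1 hY'.2.1 ?_ h.1 h.2
        exact List.getLast?_concat (l := v1 :: Y1)
  rw [List.reverse_append, List.reverse_singleton, List.singleton_append] at hc1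
  -- Together the segments bound the degree sum by `(|X| + 1) + (|Y| + 1) = |W|`.
  have k1 := List.countP_add_countP_le_of_isChain _ _ _ _ hc1
  have k2 := List.countP_add_countP_le_of_isChain _ _ _ _ hc2
  have hlen := hl.length_eq
  rw [hl.card_nbrs_eq K, hl.card_nbrs_eq K] at hdeg
  simp only [List.countP_append, List.countP_cons, List.countP_reverse, List.length_reverse,
    List.length_append, List.length_cons, decide_eq_true_eq] at k1 k2 hdeg hlen
  have h1 : ¬ K.Adj v1 u1 := fun h => huv h.symm
  simp only [huv, h1, K.irrefl, if_false] at k1 k2 hdeg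
  omega

theorem exists_isSpanningPath_of_complete (hab : a ≠ b) (ha : a ∈ W) (hb : b ∈ W)
    (h : ∀ u ∈ W, ∀ v ∈ W, u ≠ v → K.Adj u v) : ∃ l, K.IsSpanningPath W a b l := by
  classical
  have hnd : (a :: (((W.erase a).erase b).toList ++ [b])).Nodup := by
    simp [List.nodup_append, hab, Finset.nodup_toList]
    tauto
  have hmem : ∀ v, v ∈ a :: (((W.erase a).erase b).toList ++ [b]) ↔ v ∈ W := by
    intro v
    simp only [List.mem_cons, List.mem_append, Finset.mem_toList, Finset.mem_erase,
      List.not_mem_nil, or_false]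
    grind
  refine ⟨a :: (((W.erase a).erase b).toList ++ [b]), hnd, hmem, ?_, by simp, ?_⟩
  swap
  · exact List.getLast?_concat (l := a :: ((W.erase a).erase b).toList)
  have := List.Pairwise.isChain hnd
  exact this.imp_of_mem_imp fun p q hp hq hpq => h p ((hmem p).1 hp) q ((hmem q).1 hq) hpq

/-- Vertices `A` of large degree together with few vertices `C` having enough neighbours in `A`
carry a spanning path between any two vertices of `A`. -/
theorem exists_isSpanningPath [Finite V] [DecidableEq V] {A C : Finset V} (hAC : Disjoint A C)
    (hab : a ≠ b) (ha : a ∈ A) (hb : b ∈ A)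
    (hA : ∀ v ∈ A, A.card + C.card + 1 ≤ 2 * (K.nbrs (A ∪ C) v).card)
    (hC : ∀ v ∈ C, C.card + 2 ≤ (K.nbrs A v).card) (hcard : C.card + 1 ≤ A.card) :
    ∃ l, K.IsSpanningPath (A ∪ C) a b l := by
  by_contra hno
  -- An edge-maximal counterexample is closed under the degree condition. This makes it complete,
  -- first inside `A`, then between `A` and `C`, then inside `C`.
  obtain ⟨M, hKM, hM⟩ := (Set.toFinite {G : SimpleGraph V |
    ¬ ∃ l, G.IsSpanningPath (A ∪ C) a b l}).exists_le_maximal hno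
  have hW : (A ∪ C).card = A.card + C.card := Finset.card_union_of_disjoint hAC
  have key : ∀ u v, u ≠ v →
      A.card + C.card + 1 ≤ (M.nbrs (A ∪ C) u).card + (M.nbrs (A ∪ C) v).card → M.Adj u v := by
    intro u v huv hd
    by_contra hn
    refine hM.1 (exists_isSpanningPath_of_sup_edge hn (by omega) ?_)
    by_contra hno'
    have := hM.2 (y := M ⊔ edge u v) hno' le_sup_left
    apply hn
    apply this
    simp [edge_adj, huv]
  have hAA : ∀ u ∈ A, ∀ v ∈ A, u ≠ v → M.Adj u v := by
    intro u hu v hv huv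
    apply key u v huv
    have h1 := hA u hu
    have h2 := hA v hv
    have h3 := card_nbrs_mono hKM (Finset.Subset.refl (A ∪ C)) u
    have h4 := card_nbrs_mono hKM (Finset.Subset.refl (A ∪ C)) v
    omega
  have hAcard : ∀ u ∈ A, A.card - 1 ≤ (M.nbrs (A ∪ C) u).card := by
    intro u hu
    rw [← Finset.card_erase_of_mem hu]
    refine Finset.card_le_card fun w hw => ?_
    rw [Finset.mem_erase] at hw
    exact mem_nbrs.2 ⟨Finset.mem_union_left _ hw.2, hAA u hu w hw.2 hw.1.symm⟩
  have hCA : ∀ u ∈ C, ∀ v ∈ A, M.Adj u v := by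
    intro u hu v hv
    apply key u v (fun e => Finset.disjoint_left.1 hAC hv (e ▸ hu))
    have h1 := hAcard v hv
    have h2 := hC u hu
    have h3 := card_nbrs_mono hKM (Finset.subset_union_left (s₁ := A) (s₂ := C)) u
    have := Finset.card_pos.2 ⟨v, hv⟩
    omega
  have hCcard : ∀ u ∈ C, A.card ≤ (M.nbrs (A ∪ C) u).card := fun u hu =>
    Finset.card_le_card fun w hw => mem_nbrs.2 ⟨Finset.mem_union_left _ hw, hCA u hu w hw⟩
  have hCC : ∀ u ∈ C, ∀ v ∈ C, u ≠ v → M.Adj u v := by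
    intro u hu v hv huv
    apply key u v huv
    have h1 := hCcard u hu
    have h2 := hCcard v hv
    omega
  refine hM.1 (exists_isSpanningPath_of_complete hab (Finset.mem_union_left _ ha)
    (Finset.mem_union_left _ hb) fun u hu v hv huv => ?_)
  rcases Finset.mem_union.1 hu with hu | hu <;> rcases Finset.mem_union.1 hv with hv | hv
  · exact hAA u hu v hv huv
  · exact (hCA v hv u hu).symm
  · exact hCA u hu v hv
  · exact hCC u hu v hv huv

theorem exists_isHamiltonianCycle_of_list [Fintype V] [DecidableEq V] (hl : l.Nodup)
    (hmem : ∀ v, v ∈ l) (hlen : 3 ≤ l.length) (hchain : l.IsChain G.Adj)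
    (hclose : ∀ x ∈ l.getLast?, ∀ y ∈ l.head?, G.Adj x y) :
    ∃ (v : V) (p : G.Walk v v), p.IsHamiltonianCycle := by
  have hne : l ≠ [] := by rintro rfl; simp at hlen
  let p := Walk.ofSupport l hne hchain
  have hps : p.support = l := Walk.support_ofSupport ..
  have hp : p.IsPath := by rw [Walk.isPath_def, hps]; exact hl
  have hadj : G.Adj (l.getLast hne) (l.head hne) :=
    hclose _ (List.getLast?_eq_getLast_of_ne_nil hne) _ (List.head?_eq_some_head hne)
  have hcyc : (Walk.cons hadj p).IsCycle := by
    rw [Walk.cons_isCycle_iff]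
    refine ⟨hp, fun he => ?_⟩
    rw [Sym2.eq_swap] at he
    have h1 := hp.length_eq_one_of_mem_edges he
    have h2 := p.length_support
    rw [hps] at h2
    omega
  refine ⟨_, Walk.cons hadj p, hcyc, ?_⟩
  have : (Walk.cons hadj p).tail.IsPath := hcyc.isPath_tail
  refine this.isHamiltonian_of_mem fun w => ?_
  rw [Walk.support_tail_of_not_nil _ Walk.not_nil_cons]
  simp [hps, hmem]

/-- The cyclic order is `a ⋯ a', s', b' ⋯ b, s`. -/
theorem exists_isHamiltonianCycle_of_isSpanningPath [Fintype V] [DecidableEq V] {A B : Finset V}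
    {a a' b b' s s' : V} {l m : List V} (hl : G.IsSpanningPath A a a' l)
    (hm : G.IsSpanningPath B b' b m) (hAB : Disjoint A B) (hss : s ≠ s') (hsA : s ∉ A) (hsB : s ∉ B)
    (hsA' : s' ∉ A) (hsB' : s' ∉ B) (huniv : ∀ v, v ∈ A ∨ v ∈ B ∨ v = s ∨ v = s')
    (h1 : G.Adj s a) (h2 : G.Adj s' a') (h3 : G.Adj s b) (h4 : G.Adj s' b') :
    ∃ (v : V) (p : G.Walk v v), p.IsHamiltonianCycle := by
  have hl0 : l ≠ [] := by rintro rfl; simpa using hl.head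
  have hm0 : m ≠ [] := by rintro rfl; simpa using hm.head
  apply exists_isHamiltonianCycle_of_list (l := (l ++ [s']) ++ (m ++ [s]))
  · have := fun v => hl.mem_iff v
    have := fun v => hm.mem_iff v
    rw [List.nodup_append, List.nodup_append, List.nodup_append]
    refine ⟨⟨hl.nodup, by simp, ?_⟩, ⟨hm.nodup, by simp, ?_⟩, ?_⟩
    · simp only [List.mem_singleton]; grind
    · simp only [List.mem_singleton]; grind
    · have := Finset.disjoint_left.1 hAB
      simp only [List.mem_append, List.mem_singleton]; grind
  · intro v
    simp only [List.mem_append, List.mem_singleton, hl.mem_iff, hm.mem_iff]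
    have := huniv v
    tauto
  · have := List.length_pos_of_ne_nil hl0
    have := List.length_pos_of_ne_nil hm0
    simp
    omega
  · refine List.isChain_append.2 ⟨List.isChain_append.2 ⟨hl.isChain, by simp, ?_⟩,
      List.isChain_append.2 ⟨hm.isChain, by simp, ?_⟩, ?_⟩
    · rw [hl.last]; simp [h2.symm]
    · rw [hm.last]; simp [h3.symm]
    · simp [hm.head, h4]
  · rw [← List.append_assoc, List.getLast?_append_of_ne_nil _ (by simp)]
    simp [hl.head, h1]

end SimpleGraph

/-! ### Extracting Hamiltonian cycles one at a time from a dense split. -/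

namespace SimpleGraph

variable {V : Type*} {G K : SimpleGraph V} {A B T U F W W' : Finset V}
  {k ℓ x y j : ℕ}

theorem IsSpanningPath.mono_of_mem {a b : V} {l : List V} (h : G.IsSpanningPath W a b l)
    (hK : ∀ u ∈ W, ∀ v ∈ W, G.Adj u v → K.Adj u v) : K.IsSpanningPath W a b l where
  nodup := h.nodup
  mem_iff := h.mem_iff
  isChain := h.isChain.imp_of_mem_imp fun u v hu hv huv =>
    hK u ((h.mem_iff u).1 hu) v ((h.mem_iff v).1 hv) huv
  head := h.head
  last := h.last

/-- The subgraph of `K` in which edges between `T` and `A`, and between `U` and `B`, are only kept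
at the vertices of `F`. -/
def restrictMinority (K : SimpleGraph V) (A B T U F : Finset V) : SimpleGraph V where
  Adj u v := K.Adj u v ∧ (u ∈ T → v ∈ A → v ∈ F) ∧ (v ∈ T → u ∈ A → u ∈ F) ∧
    (u ∈ U → v ∈ B → v ∈ F) ∧ (v ∈ U → u ∈ B → u ∈ F)
  symm := ⟨fun _ _ h => ⟨h.1.symm, h.2.2.1, h.2.1, h.2.2.2.2, h.2.2.2.1⟩⟩
  loopless := ⟨fun _ h => K.irrefl h.1⟩

theorem restrictMinority_le : K.restrictMinority A B T U F ≤ K := fun _ _ h => h.1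

variable [DecidableEq V]

theorem card_nbrs_union_le (v : V) :
    (K.nbrs (W ∪ W') v).card ≤ (K.nbrs W v).card + (K.nbrs W' v).card := by
  refine (Finset.card_le_card fun w hw => ?_).trans (Finset.card_union_le _ _)
  simp only [Finset.mem_union, mem_nbrs] at hw ⊢
  tauto

/-- A dense set `A` together with the part `C` of `S` whose vertices have many neighbours in `A`
carries a spanning path between any two vertices of `A`. -/
theorem exists_isSpanningPath_of_dense [Finite V] {S C : Finset V} {a a' : V}
    (hAS : Disjoint A S) (hCS : C ⊆ S) (hC : C.card + 2 ≤ S.card) (hy : y + 2 ≤ S.card)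
    (hA : 2 * S.card + 4 * ℓ + y ≤ A.card + 2) (hj : j + 1 ≤ ℓ)
    (hdeg : ∀ v ∈ A, A.card + S.card ≤ (K.nbrs (A ∪ S) v).card + (y + 2 + 2 * j))
    (hdegC : ∀ v ∈ C, S.card + 2 * ℓ ≤ (K.nbrs A v).card + (2 + 2 * j))
    (haa : a ≠ a') (ha : a ∈ A) (ha' : a' ∈ A) :
    ∃ l, K.IsSpanningPath (A ∪ C) a a' l := by
  refine exists_isSpanningPath (hAS.mono_right hCS) haa ha ha' (fun v hv => ?_)
    (fun v hv => ?_) (by omega)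
  · have h1 := hdeg v hv
    have h2 := card_nbrs_union_le (K := K) (W := A ∪ C) (W' := S \ C) v
    rw [Finset.union_assoc, Finset.union_sdiff_of_subset hCS] at h2
    have h3 := Finset.card_le_card (nbrs_subset (G := K) (W := S \ C) (v := v))
    have h4 := Finset.card_sdiff_add_card_eq_card hCS
    omega
  · have h1 := hdegC v hv
    omega

/-- A vertex partition `A, B, T ∪ U` of `G` in which `A` and `B` are dense, vertices of `A` and `B`
miss few vertices of `T ∪ U`, and the vertices of `T` (of `U`) have many neighbours in `B`
(in `A`). -/
structure IsDenseSplit (G : SimpleGraph V) (A B T U : Finset V) (k ℓ x y : ℕ) : Prop where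
  disjoint_AB : Disjoint A B
  disjoint_A : Disjoint A (T ∪ U)
  disjoint_B : Disjoint B (T ∪ U)
  disjoint_TU : Disjoint T U
  cover : ∀ v, v ∈ A ∨ v ∈ B ∨ v ∈ T ∪ U
  card_sep : (T ∪ U).card = k
  le_k : x + y + 2 ≤ k
  card_A : 2 * k + 4 * ℓ + y ≤ A.card + 2
  card_B : 2 * k + 4 * ℓ + x ≤ B.card + 2
  nbrs_A : ∀ a ∈ A, k ≤ (G.nbrs (T ∪ U) a).card + y
  nbrs_B : ∀ b ∈ B, k ≤ (G.nbrs (T ∪ U) b).card + x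

theorem IsDenseSplit.swap (h : G.IsDenseSplit A B T U k ℓ x y) :
    G.IsDenseSplit B A U T k ℓ y x where
  disjoint_AB := h.disjoint_AB.symm
  disjoint_A := by rw [Finset.union_comm]; exact h.disjoint_B
  disjoint_B := by rw [Finset.union_comm]; exact h.disjoint_A
  disjoint_TU := h.disjoint_TU.symm
  cover v := by rw [Finset.union_comm]; have := h.cover v; tauto
  card_sep := by rw [Finset.union_comm]; exact h.card_sep
  le_k := by have := h.le_k; omega
  card_A := h.card_B
  card_B := h.card_A
  nbrs_A := by rw [Finset.union_comm]; exact h.nbrs_B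
  nbrs_B := by rw [Finset.union_comm]; exact h.nbrs_A

/-- What is left of `G` after removing `j` Hamiltonian cycles and two matchings: the edges between
`T` and `A`, and those between `U` and `B`, are untouched outside a small set `F`. -/
structure IsRemainder (G K : SimpleGraph V) (A B T U F : Finset V) (k ℓ x y j : ℕ) : Prop where
  nbrs_A : ∀ a ∈ A, A.card + k ≤ (K.nbrs (A ∪ (T ∪ U)) a).card + (y + 2 + 2 * j)
  nbrs_B : ∀ b ∈ B, B.card + k ≤ (K.nbrs (B ∪ (T ∪ U)) b).card + (x + 2 + 2 * j)
  nbrs_T : ∀ s ∈ T, k + 2 * ℓ ≤ (K.nbrs B s).card + (2 + 2 * j)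
  nbrs_U : ∀ s ∈ U, k + 2 * ℓ ≤ (K.nbrs A s).card + (2 + 2 * j)
  fresh_A : ∀ s ∈ T, ∀ a ∈ A, a ∉ F → G.Adj a s → K.Adj a s
  fresh_B : ∀ s ∈ U, ∀ b ∈ B, b ∉ F → G.Adj b s → K.Adj b s
  card_FA : (A ∩ F).card ≤ k + 4 * j
  card_FB : (B ∩ F).card ≤ k + 4 * j

theorem IsRemainder.swap (h : IsRemainder G K A B T U F k ℓ x y j) :
    IsRemainder G K B A U T F k ℓ y x j where
  nbrs_A := by rw [Finset.union_comm U]; exact h.nbrs_B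
  nbrs_B := by rw [Finset.union_comm U]; exact h.nbrs_A
  nbrs_T := h.nbrs_U
  nbrs_U := h.nbrs_T
  fresh_A := h.fresh_B
  fresh_B := h.fresh_A
  card_FA := h.card_FB
  card_FB := h.card_FA

/-- At least two vertices of `A` lie outside `F`. They keep all their `G`-edges to `T`, and so miss
at most `y` vertices of `T`. -/
theorem IsDenseSplit.exists_fresh (hG : G.IsDenseSplit A B T U k ℓ x y)
    (hK : IsRemainder G K A B T U F k ℓ x y j) (hj : j + 1 ≤ ℓ) :
    ∃ a ∈ A, ∃ a' ∈ A, a ≠ a' ∧ T.card ≤ (K.nbrs T a).card + y ∧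
      T.card ≤ (K.nbrs T a').card + y := by
  have h1 : 1 < (A \ F).card := by
    have := Finset.card_sdiff_add_card_inter A F
    have := hK.card_FA
    have := hG.card_A
    omega
  obtain ⟨a, ha, a', ha', hne⟩ := Finset.one_lt_card.1 h1
  have key : ∀ a ∈ A \ F, T.card ≤ (K.nbrs T a).card + y := by
    intro a ha
    rw [Finset.mem_sdiff] at ha
    have h2 := hG.nbrs_A a ha.1
    have h3 := card_nbrs_union_le (K := G) (W := T) (W' := U) a
    have h4 := Finset.card_le_card (nbrs_subset (G := G) (W := U) (v := a))
    have h5 := Finset.card_union_of_disjoint hG.disjoint_TU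
    have h6 := hG.card_sep
    have h7 : (G.nbrs T a).card ≤ (K.nbrs T a).card := by
      refine Finset.card_le_card fun s hs => ?_
      rw [mem_nbrs] at hs ⊢
      exact ⟨hs.1, hK.fresh_A s hs.1 a ha.1 ha.2 hs.2⟩
    omega
  exact ⟨a, (Finset.mem_sdiff.1 ha).1, a', (Finset.mem_sdiff.1 ha').1, hne, key a ha, key a' ha'⟩

/-- Two disjoint crossings from `A` to `B` through `S`. -/
def HasCrossings (K : SimpleGraph V) (A B S : Finset V) : Prop :=
  ∃ s ∈ S, ∃ s' ∈ S, ∃ a ∈ A, ∃ a' ∈ A, ∃ b ∈ B, ∃ b' ∈ B, s ≠ s' ∧ a ≠ a' ∧ b ≠ b' ∧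
    K.Adj s a ∧ K.Adj s' a' ∧ K.Adj s b ∧ K.Adj s' b'

theorem IsDenseSplit.hasCrossings_of_le_card (hG : G.IsDenseSplit A B T U k ℓ x y)
    (hK : IsRemainder G K A B T U F k ℓ x y j) (hj : j + 1 ≤ ℓ) (hT : y + 2 ≤ T.card) :
    K.HasCrossings A B (T ∪ U) := by
  obtain ⟨a, ha, a', ha', hne, h1, h2⟩ := hG.exists_fresh hK hj
  obtain ⟨s, hs⟩ := Finset.card_pos.1 (show 0 < (K.nbrs T a).card by omega)
  obtain ⟨s', hs', hss⟩ := Finset.exists_mem_ne (show 1 < (K.nbrs T a').card by omega) s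
  rw [mem_nbrs] at hs hs'
  have hk := hG.le_k
  have h3 := hK.nbrs_T s hs.1
  have h4 := hK.nbrs_T s' hs'.1
  obtain ⟨b, hb⟩ := Finset.card_pos.1 (show 0 < (K.nbrs B s).card by omega)
  obtain ⟨b', hb', hbb⟩ := Finset.exists_mem_ne (show 1 < (K.nbrs B s').card by omega) b
  rw [mem_nbrs] at hb hb'
  exact ⟨s, Finset.mem_union_left _ hs.1, s', Finset.mem_union_left _ hs'.1, a, ha, a', ha', b,
    hb.1, b', hb'.1, hss.symm, hne, hbb.symm, hs.2.symm, hs'.2.symm, hb.2, hb'.2⟩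

/-- If `|T| ≥ y + 2`, both crossings go through `T`; if `|U| ≥ x + 2`, both go through `U`.
Otherwise `x + y + 2 ≤ k` forces `|T| = y + 1` and `|U| = x + 1`, and each part supplies one. -/
theorem IsDenseSplit.hasCrossings (hG : G.IsDenseSplit A B T U k ℓ x y)
    (hK : IsRemainder G K A B T U F k ℓ x y j) (hj : j + 1 ≤ ℓ) :
    K.HasCrossings A B (T ∪ U) := by
  by_cases hT : y + 2 ≤ T.card
  · exact hG.hasCrossings_of_le_card hK hj hT
  by_cases hU : x + 2 ≤ U.card
  · have h := hG.swap.hasCrossings_of_le_card hK.swap hj hU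
    rw [Finset.union_comm] at h
    obtain ⟨s, hs, s', hs', a, ha, a', ha', b, hb, b', hb', h1, h2, h3, h4, h5, h6, h7⟩ := h
    exact ⟨s, hs, s', hs', b, hb, b', hb', a, ha, a', ha', h1, h3, h2, h6, h7, h4, h5⟩
  have hk := hG.le_k
  have hcard := Finset.card_union_of_disjoint hG.disjoint_TU
  rw [hG.card_sep] at hcard
  obtain ⟨a, ha, -, -, -, h1, -⟩ := hG.exists_fresh hK hj
  obtain ⟨b', hb', -, -, -, h2, -⟩ := hG.swap.exists_fresh hK.swap hj
  obtain ⟨s, hs⟩ := Finset.card_pos.1 (show 0 < (K.nbrs T a).card by omega)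
  obtain ⟨s', hs'⟩ := Finset.card_pos.1 (show 0 < (K.nbrs U b').card by omega)
  rw [mem_nbrs] at hs hs'
  have h3 := hK.nbrs_T s hs.1
  have h4 := hK.nbrs_U s' hs'.1
  obtain ⟨b, hb, hbb⟩ := Finset.exists_mem_ne (show 1 < (K.nbrs B s).card by omega) b'
  obtain ⟨a', ha', haa⟩ := Finset.exists_mem_ne (show 1 < (K.nbrs A s').card by omega) a
  rw [mem_nbrs] at hb ha'
  exact ⟨s, Finset.mem_union_left _ hs.1, s', Finset.mem_union_right _ hs'.1, a, ha, a', ha'.1, b,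
    hb.1, b', hb', fun e => Finset.disjoint_left.1 hG.disjoint_TU hs.1 (e ▸ hs'.1), haa.symm, hbb,
    hs.2.symm, ha'.2, hb.2, hs'.2.symm⟩

theorem IsDenseSplit.exists_isHamiltonianCycle [Fintype V]
    (hG : G.IsDenseSplit A B T U k ℓ x y)
    (hK : IsRemainder G K A B T U F k ℓ x y j) (hj : j + 1 ≤ ℓ) :
    ∃ (X : Finset V), X.card ≤ 4 ∧ ∃ (v : V)
      (p : (K.restrictMinority A B T U (F ∪ X)).Walk v v), p.IsHamiltonianCycle := by
  obtain ⟨s, hs, s', hs', a, ha, a', ha', b, hb, b', hb', hss, haa, hbb, h1, h2, h3, h4⟩ :=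
    hG.hasCrossings hK hj
  refine ⟨{a, a', b, b'}, Finset.card_le_four, ?_⟩
  have hAB := Finset.disjoint_left.1 hG.disjoint_AB
  have hAS := Finset.disjoint_left.1 hG.disjoint_A
  have hBS := Finset.disjoint_left.1 hG.disjoint_B
  have hTU := Finset.disjoint_left.1 hG.disjoint_TU
  have hk := hG.le_k
  have hsep := hG.card_sep
  have hpair : ({s, s'} : Finset V) ⊆ T ∪ U := by
    intro w hw
    simp only [Finset.mem_insert, Finset.mem_singleton] at hw
    rcases hw with rfl | rfl <;> assumption
  have hcard := Finset.card_sdiff_add_card_eq_card hpair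
  rw [Finset.card_pair hss] at hcard
  have hle : ∀ X ⊆ T ∪ U, (X \ {s, s'}).card + 2 ≤ (T ∪ U).card := by
    intro X hX
    have := Finset.card_le_card (Finset.sdiff_subset_sdiff hX (Finset.Subset.refl {s, s'}))
    omega
  have hUS := Finset.subset_union_right (s₁ := T) (s₂ := U)
  have hTS := Finset.subset_union_left (s₁ := T) (s₂ := U)
  obtain ⟨l, hl⟩ := exists_isSpanningPath_of_dense (K := K) (ℓ := ℓ) (j := j) (y := y)
    hG.disjoint_A (Finset.sdiff_subset.trans hUS) (hle U hUS) (by omega)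
    (by rw [hsep]; exact hG.card_A) hj (by rw [hsep]; exact hK.nbrs_A)
    (by rw [hsep]; exact fun v hv => hK.nbrs_U v (Finset.mem_sdiff.1 hv).1) haa ha ha'
  obtain ⟨m, hm⟩ := exists_isSpanningPath_of_dense (K := K) (ℓ := ℓ) (j := j) (y := x)
    hG.disjoint_B (Finset.sdiff_subset.trans hTS) (hle T hTS) (by omega)
    (by rw [hsep]; exact hG.card_B) hj (by rw [hsep]; exact hK.nbrs_B)
    (by rw [hsep]; exact fun v hv => hK.nbrs_T v (Finset.mem_sdiff.1 hv).1) hbb.symm hb' hb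
  -- This path stays in `A ∪ U`, so it has no `T`–`A` or `U`–`B` edge; the other path is symmetric.
  have hl' := hl.mono_of_mem (K := K.restrictMinority A B T U (F ∪ {a, a', b, b'})) (by
    intro u hu v hv huv
    simp only [Finset.mem_union, Finset.mem_sdiff] at hu hv
    refine ⟨huv, ?_, ?_, ?_, ?_⟩ <;> grind)
  have hm' := hm.mono_of_mem (K := K.restrictMinority A B T U (F ∪ {a, a', b, b'})) (by
    intro u hu v hv huv
    simp only [Finset.mem_union, Finset.mem_sdiff] at hu hv
    refine ⟨huv, ?_, ?_, ?_, ?_⟩ <;> grind)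
  have hcross : ∀ w ∈ T ∪ U, ∀ z ∈ ({a, a', b, b'} : Finset V), z ∈ A ∨ z ∈ B → K.Adj w z →
      (K.restrictMinority A B T U (F ∪ {a, a', b, b'})).Adj w z := by
    intro w hw z hz hzAB hwz
    refine ⟨hwz, fun _ _ => Finset.mem_union_right _ hz, ?_, fun _ _ => Finset.mem_union_right _ hz,
      ?_⟩ <;> grind
  refine exists_isHamiltonianCycle_of_isSpanningPath hl' hm' ?_ hss ?_ ?_ ?_ ?_ ?_
    (hcross s hs a (by simp) (.inl ha) h1) (hcross s' hs' a' (by simp) (.inl ha') h2)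
    (hcross s hs b (by simp) (.inr hb) h3) (hcross s' hs' b' (by simp) (.inr hb') h4)
  · rw [Finset.disjoint_left]
    intro w hw hw'
    simp only [Finset.mem_union, Finset.mem_sdiff] at hw hw'
    grind
  · simp only [Finset.mem_union, Finset.mem_sdiff]; grind
  · simp only [Finset.mem_union, Finset.mem_sdiff]; grind
  · simp only [Finset.mem_union, Finset.mem_sdiff]; grind
  · simp only [Finset.mem_union, Finset.mem_sdiff]; grind
  · intro v
    have := hG.cover v
    simp only [Finset.mem_union, Finset.mem_sdiff, Finset.mem_insert, Finset.mem_singleton] at this ⊢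
    tauto

theorem Walk.IsHamiltonianCycle.card_filter_mem_edges_le {v a : V} {p : K.Walk a a}
    (hp : p.IsHamiltonianCycle) (W : Finset V) : {w ∈ W | s(v, w) ∈ p.edges}.card ≤ 2 := by
  have h2 := hp.isCycle.ncard_neighborSet_toSubgraph_eq_two (hp.mem_support v)
  have hfin : (p.toSubgraph.neighborSet v).Finite := Set.finite_of_ncard_ne_zero (by omega)
  rw [Set.ncard_eq_toFinset_card _ hfin] at h2
  rw [← h2]
  refine Finset.card_le_card fun w hw => ?_
  rw [Set.Finite.mem_toFinset, Subgraph.mem_neighborSet, ← Subgraph.mem_edgeSet,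
    Walk.mem_edges_toSubgraph]
  exact (Finset.mem_filter.1 hw).2

theorem card_nbrs_le_deleteEdges_iUnion_add {ι : Type*} [Fintype ι] (c : ι → Σ a, K.Walk a a)
    (hc : ∀ i, (c i).2.IsHamiltonianCycle) (W : Finset V) (v : V) :
    (K.nbrs W v).card ≤
      ((K.deleteEdges (⋃ i, (c i).2.edgeSet)).nbrs W v).card + 2 * Fintype.card ι := by
  have h : K.nbrs W v ⊆ (K.deleteEdges (⋃ i, (c i).2.edgeSet)).nbrs W v ∪
      Finset.univ.biUnion fun i => {w ∈ W | s(v, w) ∈ (c i).2.edges} := by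
    intro w hw
    rw [mem_nbrs] at hw
    rw [Finset.mem_union, mem_nbrs, deleteEdges_adj, Finset.mem_biUnion]
    by_cases h : s(v, w) ∈ ⋃ i, (c i).2.edgeSet
    · obtain ⟨i, hi⟩ := Set.mem_iUnion.1 h
      exact .inr ⟨i, Finset.mem_univ i, Finset.mem_filter.2 ⟨hw.1, hi⟩⟩
    · exact .inl ⟨hw.1, hw.2, h⟩
  have h1 := (Finset.card_le_card h).trans (Finset.card_union_le _ _)
  have h2 := Finset.card_biUnion_le_card_mul Finset.univ
    (fun i => {w ∈ W | s(v, w) ∈ (c i).2.edges}) 2 fun i _ => (hc i).card_filter_mem_edges_le W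
  rw [Finset.card_univ] at h2
  omega

theorem card_nbrs_le_deleteEdges_add_two {v a : V} {p : K.Walk a a} (hp : p.IsHamiltonianCycle) :
    (K.nbrs W v).card ≤ ((K.deleteEdges p.edgeSet).nbrs W v).card + 2 := by
  have := card_nbrs_le_deleteEdges_iUnion_add (ι := Unit) (fun _ => ⟨a, p⟩) (fun _ => hp) W v
  rwa [Set.iUnion_const, Fintype.card_unit] at this

/-- The cycle is sought in `restrictMinority`, so minority edges outside `F ∪ X` survive, while each
vertex loses at most two edges. Hence the increments `4` and `2` per round in `IsRemainder`. -/
theorem IsDenseSplit.exists_step [Fintype V] (hG : G.IsDenseSplit A B T U k ℓ x y)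
    (hK : IsRemainder G K A B T U F k ℓ x y j) (hj : j + 1 ≤ ℓ) :
    ∃ (v : V) (p : K.Walk v v) (F' : Finset V), p.IsHamiltonianCycle ∧
      IsRemainder G (K.deleteEdges p.edgeSet) A B T U F' k ℓ x y (j + 1) := by
  obtain ⟨X, hX, v, p, hp⟩ := hG.exists_isHamiltonianCycle hK hj
  have hp' : (p.mapLe restrictMinority_le).IsHamiltonianCycle :=
    hp.map (f := Hom.ofLE restrictMinority_le) Function.bijective_id
  have hadj : ∀ u w, s(u, w) ∈ (p.mapLe restrictMinority_le).edgeSet →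
      (K.restrictMinority A B T U (F ∪ X)).Adj u w := by
    intro u w h
    rw [Walk.mem_edgeSet, Walk.edges_mapLe_eq_edges] at h
    exact p.adj_of_mem_edges h
  have hFX : ∀ C : Finset V, (C ∩ F).card ≤ k + 4 * j →
      (C ∩ (F ∪ X)).card ≤ k + 4 * (j + 1) := by
    intro C hC
    rw [Finset.inter_union_distrib_left]
    have := Finset.card_union_le (C ∩ F) (C ∩ X)
    have := Finset.card_le_card (Finset.inter_subset_right (s₁ := C) (s₂ := X))
    omega
  refine ⟨v, p.mapLe restrictMinority_le, F ∪ X, hp', ?_, ?_, ?_, ?_, ?_, ?_, hFX A hK.card_FA,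
    hFX B hK.card_FB⟩
  · intro a ha
    have := hK.nbrs_A a ha
    have := card_nbrs_le_deleteEdges_add_two (W := A ∪ (T ∪ U)) (v := a) hp'
    omega
  · intro a ha
    have := hK.nbrs_B a ha
    have := card_nbrs_le_deleteEdges_add_two (W := B ∪ (T ∪ U)) (v := a) hp'
    omega
  · intro a ha
    have := hK.nbrs_T a ha
    have := card_nbrs_le_deleteEdges_add_two (W := B) (v := a) hp'
    omega
  · intro a ha
    have := hK.nbrs_U a ha
    have := card_nbrs_le_deleteEdges_add_two (W := A) (v := a) hp'
    omega
  · intro s hs a ha haF h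
    rw [Finset.mem_union, not_or] at haF
    rw [deleteEdges_adj]
    refine ⟨hK.fresh_A s hs a ha haF.1 h, fun h' => ?_⟩
    have := (hadj _ _ h').2.2.1 hs ha
    simp only [Finset.mem_union] at this
    tauto
  · intro s hs a ha haF h
    rw [Finset.mem_union, not_or] at haF
    rw [deleteEdges_adj]
    refine ⟨hK.fresh_B s hs a ha haF.1 h, fun h' => ?_⟩
    have := (hadj _ _ h').2.2.2.2 hs ha
    simp only [Finset.mem_union] at this
    tauto

/-- Edge-disjoint Hamiltonian cycles can be removed until `ℓ` of them are found. -/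
theorem IsDenseSplit.exists_cycles [Fintype V] (hG : G.IsDenseSplit A B T U k ℓ x y) (m : ℕ) :
    ∀ (j : ℕ) (K : SimpleGraph V) (F : Finset V), IsRemainder G K A B T U F k ℓ x y j →
      j + m ≤ ℓ → ∃ c : Fin m → Σ a, K.Walk a a, (∀ i, (c i).2.IsHamiltonianCycle) ∧
        ∀ i i', i ≠ i' → Disjoint (c i).2.edgeSet (c i').2.edgeSet := by
  induction m with
  | zero => exact fun j K F _ _ => ⟨Fin.elim0, fun i => i.elim0, fun i => i.elim0⟩
  | succ m ih =>
    intro j K F hK hj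
    obtain ⟨v, p, F', hp, hK'⟩ := hG.exists_step hK (by omega)
    obtain ⟨c, hc, hdis⟩ := ih (j + 1) _ F' hK' (by omega)
    have hle : K.deleteEdges p.edgeSet ≤ K := deleteEdges_le _
    have hes : ∀ i, ((c i).2.mapLe hle).edgeSet = (c i).2.edgeSet := by
      intro i
      ext e
      rw [Walk.mem_edgeSet, Walk.mem_edgeSet, Walk.edges_mapLe_eq_edges]
    have hp0 : ∀ i, Disjoint p.edgeSet (c i).2.edgeSet := by
      intro i
      rw [Set.disjoint_left]
      intro e he he'
      have := (c i).2.edges_subset_edgeSet he'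
      rw [edgeSet_deleteEdges] at this
      exact this.2 he
    refine ⟨Fin.cons ⟨v, p⟩ fun i => ⟨(c i).1, (c i).2.mapLe hle⟩, ?_, ?_⟩
    · intro i
      refine Fin.cases ?_ (fun i => ?_) i
      · exact hp
      · exact (hc i).map (f := Hom.ofLE hle) Function.bijective_id
    · intro i i' hne
      induction i using Fin.cases with
      | zero =>
        induction i' using Fin.cases with
        | zero => exact absurd rfl hne
        | succ i' =>
          change Disjoint p.edgeSet ((c i').2.mapLe hle).edgeSet
          rw [hes]
          exact hp0 i'
      | succ i =>
        induction i' using Fin.cases with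
        | zero =>
          change Disjoint ((c i).2.mapLe hle).edgeSet p.edgeSet
          rw [hes]
          exact (hp0 i).symm
        | succ i' =>
          change Disjoint ((c i).2.mapLe hle).edgeSet ((c i').2.mapLe hle).edgeSet
          rw [hes, hes]
          exact hdis i i' fun e => hne (by rw [e])

end SimpleGraph

/-! ### Separations, matchings out of a minimum separator, and lower bounds on connectivity. -/

namespace SimpleGraph

variable {V : Type*} {G H : SimpleGraph V} {A B S P Q R : Finset V} {k ℓ x y : ℕ}

/-- `S` separates the nonempty sets `A` and `B` in `G`. -/
structure IsSeparation (G : SimpleGraph V) (S A B : Finset V) : Prop where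
  nonempty_A : A.Nonempty
  nonempty_B : B.Nonempty
  disjoint_AB : Disjoint A B
  disjoint_A : Disjoint A S
  disjoint_B : Disjoint B S
  cover : ∀ v, v ∈ A ∨ v ∈ B ∨ v ∈ S
  not_adj : ∀ a ∈ A, ∀ b ∈ B, ¬ G.Adj a b

theorem IsSeparation.symm (h : G.IsSeparation S A B) : G.IsSeparation S B A where
  nonempty_A := h.nonempty_B
  nonempty_B := h.nonempty_A
  disjoint_AB := h.disjoint_AB.symm
  disjoint_A := h.disjoint_B
  disjoint_B := h.disjoint_A
  cover v := by have := h.cover v; tauto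
  not_adj a ha b hb hab := h.not_adj b hb a ha hab.symm

theorem IsSeparation.anti (h : G.IsSeparation S A B) (hH : H ≤ G) : H.IsSeparation S A B where
  nonempty_A := h.nonempty_A
  nonempty_B := h.nonempty_B
  disjoint_AB := h.disjoint_AB
  disjoint_A := h.disjoint_A
  disjoint_B := h.disjoint_B
  cover := h.cover
  not_adj a ha b hb hab := h.not_adj a ha b hb (hH hab)

theorem IsSeparation.not_connected (h : G.IsSeparation S A B) :
    ¬ (G.induce {v : V | v ∉ S}).Connected := by
  intro hc
  obtain ⟨a, ha⟩ := h.nonempty_A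
  obtain ⟨b, hb⟩ := h.nonempty_B
  obtain ⟨p⟩ := hc.preconnected ⟨a, Finset.disjoint_left.1 h.disjoint_A ha⟩
    ⟨b, Finset.disjoint_left.1 h.disjoint_B hb⟩
  obtain ⟨d, -, h1, h2⟩ := p.exists_boundary_dart {v | v.1 ∈ A} ha
    (fun hb' => Finset.disjoint_left.1 h.disjoint_AB hb' hb)
  have h3 := h.cover d.snd.1
  have h4 : d.snd.1 ∉ S := d.snd.2
  have h5 : d.snd.1 ∉ A := h2
  exact h.not_adj _ h1 d.snd.1 (by tauto) d.adj

theorem exists_isSeparation [Fintype V] (hS : S ≠ Finset.univ)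
    (h : ¬ (G.induce {v : V | v ∉ S}).Connected) : ∃ A B, G.IsSeparation S A B := by
  classical
  obtain ⟨w, hw⟩ : ∃ w, w ∉ S := by
    by_contra! hn
    exact hS (Finset.eq_univ_iff_forall.2 hn)
  rw [connected_iff, not_and_or] at h
  rcases h with h | h
  swap
  · exact absurd ⟨⟨w, hw⟩⟩ h
  unfold Preconnected at h
  push Not at h
  obtain ⟨u, v, huv⟩ := h
  -- One side is the component of `u` in `G - S`, the other is everything else outside `S`.
  refine ⟨Finset.univ.filter fun z => ∃ hz : z ∉ S,
      (G.induce {v : V | v ∉ S}).Reachable u ⟨z, hz⟩,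
    Finset.univ.filter fun z => ∃ hz : z ∉ S,
      ¬ (G.induce {v : V | v ∉ S}).Reachable u ⟨z, hz⟩, ⟨u, ?_⟩, ⟨v, ?_⟩, ?_, ?_,
    ?_, ?_, ?_⟩
  · exact Finset.mem_filter.2 ⟨Finset.mem_univ _, u.2, Reachable.refl u⟩
  · exact Finset.mem_filter.2 ⟨Finset.mem_univ _, v.2, huv⟩
  · rw [Finset.disjoint_left]
    simp
    tauto
  · rw [Finset.disjoint_left]
    simp
    tauto
  · rw [Finset.disjoint_left]
    simp
    tauto
  · intro z
    by_cases hz : z ∈ S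
    · exact .inr (.inr hz)
    by_cases hr : (G.induce {v : V | v ∉ S}).Reachable u ⟨z, hz⟩
    · exact .inl (Finset.mem_filter.2 ⟨Finset.mem_univ _, hz, hr⟩)
    · exact .inr (.inl (Finset.mem_filter.2 ⟨Finset.mem_univ _, hz, hr⟩))
  · intro a ha b hb hab
    simp only [Finset.mem_filter, Finset.mem_univ, true_and] at ha hb
    obtain ⟨ha', hr⟩ := ha
    obtain ⟨hb', hr'⟩ := hb
    refine hr' (hr.trans (Adj.reachable ?_))
    exact hab

theorem IsSeparation.vertexConnectivity_le [Fintype V] (h : G.IsSeparation S A B) :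
    G.vertexConnectivity ≤ S.card := by
  refine Nat.sInf_le ⟨S, rfl, ?_, .inl h.not_connected⟩
  obtain ⟨a, ha⟩ := h.nonempty_A
  exact fun e => Finset.disjoint_left.1 h.disjoint_A ha (e ▸ Finset.mem_univ a)

theorem exists_isSeparation_of_lt [Fintype V] (h : G.vertexConnectivity + 1 < Fintype.card V) :
    ∃ S A B, S.card = G.vertexConnectivity ∧ G.IsSeparation S A B := by
  classical
  obtain ⟨v⟩ : Nonempty V := Fintype.card_pos_iff.1 (by omega)
  obtain ⟨S, hS, hne, hc⟩ := Nat.sInf_mem (s := {k : ℕ | ∃ S : Finset V, S.card = k ∧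
    S ≠ Finset.univ ∧ (¬ (G.induce {v : V | v ∉ S}).Connected ∨ S.card + 1 = Fintype.card V)})
    ⟨_, Finset.univ.erase v, rfl, by simp [Finset.erase_eq_self], .inr
      (Finset.card_erase_add_one (Finset.mem_univ v))⟩
  change S.card = G.vertexConnectivity at hS
  obtain ⟨A, B, hAB⟩ := exists_isSeparation hne (hc.resolve_right (by omega))
  exact ⟨S, A, B, hS, hAB⟩

variable [DecidableEq V]

/-- The vertices of a minimum separator can be matched into each side. -/
theorem IsSeparation.exists_matching [Fintype V] (h : G.IsSeparation S A B)
    (hS : S.card ≤ G.vertexConnectivity) (hA : S.card ≤ A.card) :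
    ∃ f : V → V, Set.InjOn f S ∧ ∀ s ∈ S, f s ∈ A ∧ G.Adj s (f s) := by
  have hall : ∀ X : Finset S, X.card ≤ (X.biUnion fun s => G.nbrs A s.1).card := by
    intro X
    by_contra! hlt
    set N := X.biUnion fun s => G.nbrs A s.1
    have hNA : N ⊆ A := Finset.biUnion_subset.2 fun s _ => nbrs_subset
    have hmem : ∀ s, ∀ hs : s ∈ S, ⟨s, hs⟩ ∈ X → ∀ a ∈ A, G.Adj a s → a ∈ N := by
      intro s hs hX a ha hadj
      exact Finset.mem_biUnion.2 ⟨⟨s, hs⟩, hX, mem_nbrs.2 ⟨ha, hadj.symm⟩⟩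
    have hXcard : (X.map (Function.Embedding.subtype _)).card = X.card := Finset.card_map _
    have hXS : X.map (Function.Embedding.subtype _) ⊆ S := by
      intro s hs
      simp at hs
      exact hs.1
    have hXm : ∀ s, s ∈ X.map (Function.Embedding.subtype _) ↔ ∃ hs : s ∈ S, ⟨s, hs⟩ ∈ X := by
      simp
    have hsub := Finset.card_sdiff_add_card_eq_card hXS
    have h1 := Finset.disjoint_left.1 h.disjoint_A
    have h2 := Finset.disjoint_left.1 h.disjoint_B
    have h3 := Finset.disjoint_left.1 h.disjoint_AB
    generalize hYdef : X.map (Function.Embedding.subtype _) = Y at *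
    -- A Hall violator `Y` with neighbourhood `N` in `A` can be exchanged for `N`, giving a
    -- separator smaller than `S`.
    have hsep : G.IsSeparation ((S \ Y) ∪ N) (A \ N) (B ∪ Y) := by
      refine ⟨?_, h.nonempty_B.mono Finset.subset_union_left, ?_, ?_, ?_, ?_, ?_⟩
      · have := Finset.card_sdiff_add_card_eq_card hNA
        rw [← Finset.card_pos]
        omega
      · rw [Finset.disjoint_left]
        intro v hv hv'
        simp only [Finset.mem_sdiff, Finset.mem_union] at hv hv'
        have := @hXS v
        grind
      · rw [Finset.disjoint_left]
        intro v hv hv'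
        simp only [Finset.mem_sdiff, Finset.mem_union] at hv hv'
        grind
      · rw [Finset.disjoint_left]
        intro v hv hv'
        simp only [Finset.mem_sdiff, Finset.mem_union] at hv hv'
        have := @hXS v
        have := @hNA v
        grind
      · intro v
        have := h.cover v
        simp only [Finset.mem_sdiff, Finset.mem_union]
        tauto
      · intro a ha b hb hab
        simp only [Finset.mem_sdiff, Finset.mem_union] at ha hb
        rcases hb with hb | hb
        · exact h.not_adj a ha.1 b hb hab
        · obtain ⟨hs, hX⟩ := (hXm b).1 hb
          exact ha.2 (hmem b hs hX a ha.1 hab)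
    have h4 := hsep.vertexConnectivity_le
    have h5 := Finset.card_union_le (S \ Y) N
    omega
  obtain ⟨f, hf, hft⟩ := (Finset.all_card_le_biUnion_card_iff_exists_injective _).1 hall
  refine ⟨fun v => if hv : v ∈ S then f ⟨v, hv⟩ else v, ?_, ?_⟩
  · intro u hu v hv huv
    have hu' : u ∈ S := hu
    have hv' : v ∈ S := hv
    simp only [hu', hv', dif_pos] at huv
    simpa using hf huv
  · intro s hs
    simp only [hs, dif_pos]
    exact mem_nbrs.1 (hft ⟨s, hs⟩)

/-- A small separator cannot separate two vertices of a dense set. -/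
theorem IsSeparation.false_of_dense (h : H.IsSeparation R P Q) (hR : R.card < k)
    (hA : ∀ a ∈ A, A.card ≤ (H.nbrs A a).card + (y + 1 + 2 * ℓ)) (hy : y + 2 ≤ k)
    (hcard : 2 * k + 4 * ℓ + y ≤ A.card + 2) {u v : V} (hu : u ∈ A) (hv : v ∈ A) (huP : u ∈ P)
    (hvQ : v ∈ Q) : False := by
  have huv : ¬ H.Adj u v := h.not_adj u huP v hvQ
  have hne : u ≠ v := fun e => Finset.disjoint_left.1 h.disjoint_AB huP (e ▸ hvQ)
  have h1 := Finset.card_sdiff_add_card_eq_card (nbrs_subset (G := H) (W := A) (v := u))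
  have h2 := Finset.card_sdiff_add_card_eq_card (nbrs_subset (G := H) (W := A) (v := v))
  have h3 := Finset.card_union_add_card_inter (A \ H.nbrs A u) (A \ H.nbrs A v)
  have h4 : ({u, v} : Finset V).card ≤ ((A \ H.nbrs A u) ∩ (A \ H.nbrs A v)).card := by
    refine Finset.card_le_card fun w hw => ?_
    simp only [Finset.mem_insert, Finset.mem_singleton] at hw
    have := fun h' : H.Adj v u => huv h'.symm
    simp only [Finset.mem_inter, Finset.mem_sdiff, mem_nbrs]
    rcases hw with rfl | rfl
    · exact ⟨⟨hu, fun h' => H.irrefl h'.2⟩, hu, fun h' => this h'.2⟩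
    · exact ⟨⟨hv, fun h' => huv h'.2⟩, hv, fun h' => H.irrefl h'.2⟩
  rw [Finset.card_pair hne] at h4
  -- A common neighbour of `u` and `v` lies in `R`. The two sets of non-neighbours share `u` and
  -- `v`, so `|A| ≤ 2(y + 1 + 2ℓ) - 2 + (k - 1)`, one below the lower bound from `hcard` and `hy`.
  have h5 : A.card ≤ (((A \ H.nbrs A u) ∪ (A \ H.nbrs A v)) ∪ R).card := by
    refine Finset.card_le_card fun w hw => ?_
    simp only [Finset.mem_union, Finset.mem_sdiff, mem_nbrs]
    by_contra hn
    push Not at hn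
    rcases h.cover w with hwP | hwQ | hwR
    · exact h.not_adj w hwP v hvQ (hn.1.2 hw).2.symm
    · exact h.not_adj u huP w hwQ (hn.1.1 hw).2
    · exact hn.2 hwR
  have h6 := Finset.card_union_le ((A \ H.nbrs A u) ∪ (A \ H.nbrs A v)) R
  have h7 := hA u hu
  have h8 := hA v hv
  omega

/-- If `A` and `B` are dense and `S` is matched into both, no separator is smaller than `S`. -/
theorem IsSeparation.card_le_of_matching [Fintype V] (hS : H.IsSeparation S A B) (hk : S.card = k)
    (hA : ∀ a ∈ A, A.card ≤ (H.nbrs A a).card + (y + 1 + 2 * ℓ)) (hy : y + 2 ≤ k)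
    (hAcard : 2 * k + 4 * ℓ + y ≤ A.card + 2)
    (hB : ∀ b ∈ B, B.card ≤ (H.nbrs B b).card + (x + 1 + 2 * ℓ)) (hx : x + 2 ≤ k)
    (hBcard : 2 * k + 4 * ℓ + x ≤ B.card + 2)
    (hdeg : ∀ s ∈ S, 2 * k ≤ (H.nbrs Finset.univ s).card) {f g : V → V}
    (hf : Set.InjOn f S) (hf' : ∀ s ∈ S, f s ∈ A ∧ H.Adj s (f s))
    (hg : Set.InjOn g S) (hg' : ∀ s ∈ S, g s ∈ B ∧ H.Adj s (g s))
    (hR : H.IsSeparation R P Q) : k ≤ R.card := by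
  by_contra! hlt
  have hAS := Finset.disjoint_left.1 hS.disjoint_A
  have hBS := Finset.disjoint_left.1 hS.disjoint_B
  have hAB := Finset.disjoint_left.1 hS.disjoint_AB
  -- The triples `{s, f s, g s}` are pairwise disjoint, so fewer than `k` vertices cannot meet all
  -- of them.
  obtain ⟨s, hs, hsR, hfR, hgR⟩ : ∃ s ∈ S, s ∉ R ∧ f s ∉ R ∧ g s ∉ R := by
    by_contra! hn
    have : S.card ≤ R.card := by
      refine Finset.card_le_card_of_injOn (fun s => if s ∈ R then s else if f s ∈ R then f s else g s)
        ?_ ?_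
      · intro s hs
        have := hn s hs
        simp only [Finset.mem_coe]
        split_ifs <;> tauto
      · intro s hs t ht hst
        have h1 := hf' s hs
        have h2 := hf' t ht
        have h3 := hg' s hs
        have h4 := hg' t ht
        have h5 := @hf s hs t ht
        have h6 := @hg s hs t ht
        rw [Finset.mem_coe] at hs ht
        simp only at hst
        grind
    omega
  suffices key : ∀ P Q : Finset V, H.IsSeparation R P Q → s ∈ P → False by
    rcases hR.cover s with h | h | h
    · exact key P Q hR h
    · exact key Q P hR.symm h
    · exact hsR h
  intro P Q hR hsP
  have hnbr : ∀ w, H.Adj s w → w ∉ R → w ∈ P := by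
    intro w hw hwR
    rcases hR.cover w with h | h | h
    · exact h
    · exact absurd hw (hR.not_adj s hsP w h)
    · exact absurd h hwR
  have hfP := hnbr _ (hf' s hs).2 hfR
  have hgP := hnbr _ (hg' s hs).2 hgR
  -- Both partners of `s` lie in `P`, so density keeps `A` and `B` out of `Q`. A vertex of `Q` then
  -- has all its neighbours in `R ∪ S`, fewer than `2k`.
  have hQS : ∀ q ∈ Q, q ∈ S := by
    intro q hq
    rcases hS.cover q with h | h | h
    · exact (hR.false_of_dense hlt hA hy hAcard (hf' s hs).1 h hfP hq).elim
    · exact (hR.false_of_dense hlt hB hx hBcard (hg' s hs).1 h hgP hq).elim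
    · exact h
  obtain ⟨q, hq⟩ := hR.nonempty_B
  have h1 := hdeg q (hQS q hq)
  have h2 : (H.nbrs Finset.univ q).card ≤ (R ∪ S).card := by
    refine Finset.card_le_card fun w hw => ?_
    rw [mem_nbrs] at hw
    rcases hR.cover w with h | h | h
    · exact absurd hw.2.symm (hR.not_adj w h q hq)
    · exact Finset.mem_union_right _ (hQS w h)
    · exact Finset.mem_union_left _ h
  have h3 := Finset.card_union_le R S
  omega

end SimpleGraph

/-! ### Reserving the matchings and assembling the result. -/

namespace SimpleGraph

variable {V : Type*} {G H : SimpleGraph V} {A B S : Finset V} {d k ℓ x y : ℕ}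

theorem card_nbrs_lt_of_mem {W : Finset V} {v : V} (hv : v ∈ W) : (G.nbrs W v).card < W.card :=
  Finset.card_lt_card ⟨nbrs_subset, fun h => G.irrefl (mem_nbrs.1 (h hv)).2⟩

theorem card_nbrs_le_deleteEdges_add_one {M : Set (Sym2 V)} {W : Finset V} {v : V}
    (hM : ∀ w ∈ W, ∀ w' ∈ W, s(v, w) ∈ M → s(v, w') ∈ M → w = w') :
    (G.nbrs W v).card ≤ ((G.deleteEdges M).nbrs W v).card + 1 := by
  classical
  have h : G.nbrs W v ⊆ (G.deleteEdges M).nbrs W v ∪ {w ∈ W | s(v, w) ∈ M} := by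
    intro w hw
    rw [mem_nbrs] at hw
    rw [Finset.mem_union, mem_nbrs, deleteEdges_adj, Finset.mem_filter]
    tauto
  have h1 : {w ∈ W | s(v, w) ∈ M}.card ≤ 1 := by
    rw [Finset.card_le_one]
    intro w hw w' hw'
    rw [Finset.mem_filter] at hw hw'
    exact hM w hw.1 w' hw'.1 hw.2 hw'.2
  have h2 := (Finset.card_le_card h).trans (Finset.card_union_le _ _)
  omega

/-- The edges joining `S` to its partners under `f` and `g`. -/
def matchingEdges (S : Finset V) (f g : V → V) : Set (Sym2 V) :=
  {e | ∃ s ∈ S, e = s(s, f s) ∨ e = s(s, g s)}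

theorem matchingEdges_comm (S : Finset V) (f g : V → V) :
    matchingEdges S f g = matchingEdges S g f := by
  simp only [matchingEdges, or_comm]

theorem IsSeparation.mem_matchingEdges_iff (h : G.IsSeparation S A B) {f g : V → V}
    (hg : ∀ s ∈ S, g s ∈ B) {s a : V} (hs : s ∈ S) (ha : a ∈ A) :
    s(s, a) ∈ matchingEdges S f g ↔ a = f s := by
  have hAS := Finset.disjoint_left.1 h.disjoint_A
  have hAB := Finset.disjoint_left.1 h.disjoint_AB
  constructor
  · rintro ⟨t, ht, e | e⟩
    · rw [Sym2.eq_iff] at e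
      rcases e with ⟨rfl, e⟩ | ⟨e, rfl⟩
      · exact e
      · exact absurd ht (hAS ha)
    · rw [Sym2.eq_iff] at e
      rcases e with ⟨rfl, rfl⟩ | ⟨e, rfl⟩
      · exact absurd (hg _ hs) (hAB ha)
      · exact absurd ht (hAS ha)
  · rintro rfl
    exact ⟨s, hs, .inl rfl⟩

theorem IsSeparation.notMem_matchingEdges (h : G.IsSeparation S A B) {f g : V → V} {a a' : V}
    (ha : a ∈ A) (ha' : a' ∈ A) : s(a, a') ∉ matchingEdges S f g := by
  have hAS := Finset.disjoint_left.1 h.disjoint_A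
  rintro ⟨t, ht, e | e⟩ <;> rw [Sym2.eq_iff] at e
  · rcases e with ⟨rfl, -⟩ | ⟨-, rfl⟩
    · exact hAS ha ht
    · exact hAS ha' ht
  · rcases e with ⟨rfl, -⟩ | ⟨-, rfl⟩
    · exact hAS ha ht
    · exact hAS ha' ht

theorem IsSeparation.card_nbrs_deleteEdges_sep (h : G.IsSeparation S A B) {f g : V → V}
    (hg : ∀ s ∈ S, g s ∈ B) {s : V} (hs : s ∈ S) :
    (G.nbrs A s).card ≤ ((G.deleteEdges (matchingEdges S f g)).nbrs A s).card + 1 := by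
  refine card_nbrs_le_deleteEdges_add_one fun w hw w' hw' hm hm' => ?_
  rw [h.mem_matchingEdges_iff hg hs hw] at hm
  rw [h.mem_matchingEdges_iff hg hs hw'] at hm'
  rw [hm, hm']

variable [DecidableEq V]

theorem IsSeparation.nbrs_univ_subset [Fintype V] (h : G.IsSeparation S A B) {a : V} (ha : a ∈ A) :
    G.nbrs Finset.univ a ⊆ G.nbrs (A ∪ S) a := by
  intro w hw
  rw [mem_nbrs] at hw ⊢
  refine ⟨?_, hw.2⟩
  rcases h.cover w with hA | hB | hS
  · exact Finset.mem_union_left _ hA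
  · exact absurd hw.2 (h.not_adj a ha w hB)
  · exact Finset.mem_union_right _ hS

theorem IsSeparation.card_nbrs_deleteEdges_left (h : G.IsSeparation S A B) {f g : V → V}
    (hg : ∀ s ∈ S, g s ∈ B) (hinj : Set.InjOn f S) {a : V} (ha : a ∈ A) :
    (G.nbrs (A ∪ S) a).card ≤
      ((G.deleteEdges (matchingEdges S f g)).nbrs (A ∪ S) a).card + 1 := by
  refine card_nbrs_le_deleteEdges_add_one fun w hw w' hw' hm hm' => ?_
  have key : ∀ w ∈ A ∪ S, s(a, w) ∈ matchingEdges S f g → w ∈ S ∧ a = f w := by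
    intro w hw hm
    rcases Finset.mem_union.1 hw with hw | hw
    · exact absurd hm (h.notMem_matchingEdges ha hw)
    · exact ⟨hw, (h.mem_matchingEdges_iff hg hw ha).1 (Sym2.eq_swap ▸ hm)⟩
  obtain ⟨h1, h2⟩ := key w hw hm
  obtain ⟨h3, h4⟩ := key w' hw' hm'
  exact hinj h1 h3 (h2.symm.trans h4)

theorem IsSeparation.deleteEdges_adj_of_notMem_image (h : G.IsSeparation S A B) {f g : V → V}
    (hg : ∀ s ∈ S, g s ∈ B) {s a : V} (hs : s ∈ S) (ha : a ∈ A)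
    (hF : a ∉ S.image f) (hadj : G.Adj a s) :
    (G.deleteEdges (matchingEdges S f g)).Adj a s := by
  rw [deleteEdges_adj, Sym2.eq_swap, h.mem_matchingEdges_iff hg hs ha]
  refine ⟨hadj, ?_⟩
  rintro rfl
  exact hF (Finset.mem_image_of_mem f hs)

theorem IsSeparation.card_inter_image_le (h : G.IsSeparation S A B) {f g : V → V}
    (hg : ∀ s ∈ S, g s ∈ B) : (A ∩ (S.image f ∪ S.image g)).card ≤ S.card := by
  refine le_trans (Finset.card_le_card fun w hw => ?_) (Finset.card_image_le (f := f))
  rw [Finset.mem_inter, Finset.mem_union] at hw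
  refine hw.2.resolve_right fun hw' => ?_
  obtain ⟨t, ht, rfl⟩ := Finset.mem_image.1 hw'
  exact Finset.disjoint_left.1 h.disjoint_AB hw.1 (hg t ht)

/-- A graph with a small minimum separator and minimum degree at least half the order has `ℓ`
edge-disjoint Hamiltonian cycles whose removal preserves the connectivity. -/
theorem exists_hamiltonianCycles_vertexConnectivity_eq [Fintype V]
    (hsep : G.IsSeparation S A B) (hk : S.card = G.vertexConnectivity)
    (hd : ∀ v, d ≤ (G.nbrs Finset.univ v).card) (hn : Fintype.card V ≤ 2 * d)
    (hdk : 3 * S.card + 4 * ℓ ≤ d + 3) (hℓ : 1 ≤ ℓ) :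
    ∃ c : Fin ℓ → Σ a, G.Walk a a, (∀ i, (c i).2.IsHamiltonianCycle) ∧
      (∀ i j, i ≠ j → Disjoint (c i).2.edgeSet (c j).2.edgeSet) ∧
      (G.deleteEdges (⋃ i, (c i).2.edgeSet)).vertexConnectivity = G.vertexConnectivity := by
  have hside : ∀ {A B : Finset V}, G.IsSeparation S A B → d + 1 ≤ A.card + S.card ∧ ∀ a ∈ A,
      d ≤ (G.nbrs (A ∪ S) a).card ∧ d + 1 ≤ A.card + (G.nbrs S a).card ∧
      d ≤ (G.nbrs A a).card + S.card := by
    intro A B h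
    have key : ∀ a ∈ A, d ≤ (G.nbrs (A ∪ S) a).card ∧ d + 1 ≤ A.card + (G.nbrs S a).card ∧
      d ≤ (G.nbrs A a).card + S.card := by
      intro a ha
      have h1 := (hd a).trans (Finset.card_le_card (h.nbrs_univ_subset ha))
      have h2 := card_nbrs_union_le (K := G) (W := A) (W' := S) a
      have h3 := card_nbrs_lt_of_mem (G := G) ha
      have h4 := Finset.card_le_card (nbrs_subset (G := G) (W := S) (v := a))
      omega
    obtain ⟨a, ha⟩ := h.nonempty_A
    have h4 := Finset.card_le_card (nbrs_subset (G := G) (W := S) (v := a))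
    have := key a ha
    exact ⟨by omega, key⟩
  obtain ⟨hA, hA'⟩ := hside hsep
  obtain ⟨hB, hB'⟩ := hside hsep.symm
  -- The excesses of `|A|` and `|B|` over their minimum `d + 1 - |S|`.
  obtain ⟨y, hy⟩ := Nat.exists_eq_add_of_le hA
  obtain ⟨x, hx⟩ := Nat.exists_eq_add_of_le hB
  have hcard : A.card + B.card + S.card = Fintype.card V := by
    rw [← Finset.card_union_of_disjoint hsep.disjoint_AB, ← Finset.card_union_of_disjoint
      (Finset.disjoint_union_left.2 ⟨hsep.disjoint_A, hsep.disjoint_B⟩), ← Finset.card_univ]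
    congr 1
    ext v
    have := hsep.cover v
    simp only [Finset.mem_union, Finset.mem_univ, iff_true]
    tauto
  have hxy : x + y + 2 ≤ S.card := by omega
  obtain ⟨f, hf, hf'⟩ := hsep.exists_matching hk.le (by omega)
  obtain ⟨g, hg, hg'⟩ := hsep.symm.exists_matching hk.le (by omega)
  have hfA : ∀ s ∈ S, f s ∈ A := fun s hs => (hf' s hs).1
  have hgB : ∀ s ∈ S, g s ∈ B := fun s hs => (hg' s hs).1
  set K := G.deleteEdges (matchingEdges S f g) with hK
  have hK' : K = G.deleteEdges (matchingEdges S g f) := by rw [hK, matchingEdges_comm]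
  set T := {s ∈ S | (G.nbrs A s).card ≤ (G.nbrs B s).card} with hT
  have hTS : T ⊆ S := Finset.filter_subset _ _
  have hTU : T ∪ (S \ T) = S := Finset.union_sdiff_of_subset hTS
  -- At most `|S| - 1` neighbours of `s` lie in `S`. The larger side then has at least `|S| + 2ℓ -
  -- 1`, and one may be lost to the matching.
  have hmaj : ∀ s ∈ S, 2 * S.card + 4 * ℓ ≤ (G.nbrs A s).card + (G.nbrs B s).card + 2 := by
    intro s hs
    have h1 := (hd s).trans (Finset.card_le_card (show G.nbrs Finset.univ s ⊆
      G.nbrs (A ∪ B ∪ S) s by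
        intro w hw
        rw [mem_nbrs] at hw ⊢
        have := hsep.cover w
        simp only [Finset.mem_union]
        tauto))
    have h2 := card_nbrs_union_le (K := G) (W := A ∪ B) (W' := S) s
    have h3 := card_nbrs_union_le (K := G) (W := A) (W' := B) s
    have h4 := card_nbrs_lt_of_mem (G := G) hs
    omega
  have hsplit : G.IsDenseSplit A B T (S \ T) S.card ℓ x y := by
    refine ⟨hsep.disjoint_AB, hTU.symm ▸ hsep.disjoint_A, hTU.symm ▸ hsep.disjoint_B,
      Finset.disjoint_sdiff, ?_, by rw [hTU], hxy, by omega, by omega, ?_, ?_⟩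
    · rw [hTU]
      exact hsep.cover
    · rw [hTU]
      intro a ha
      have := hA' a ha
      omega
    · rw [hTU]
      intro a ha
      have := hB' a ha
      omega
  -- Initially only the matching partners are touched, at most `|S|` on each side. The constant `2`
  -- in the bounds on `A` and `B` covers the vertex itself and its one possible matching edge.
  have hrem : IsRemainder G K A B T (S \ T) (S.image f ∪ S.image g) S.card ℓ x y 0 := by
    refine ⟨?_, ?_, ?_, ?_, ?_, ?_, ?_, ?_⟩
    · rw [hTU]
      intro a ha
      have h1 := hA' a ha
      have h2 := hsep.card_nbrs_deleteEdges_left hgB hf ha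
      rw [← hK] at h2
      omega
    · rw [hTU]
      intro b hb
      have h1 := hB' b hb
      have h2 := hsep.symm.card_nbrs_deleteEdges_left hfA hg hb
      rw [← hK'] at h2
      omega
    · intro s hs
      have h2 := hsep.symm.card_nbrs_deleteEdges_sep (f := g) hfA (hTS hs)
      have h3 := hmaj s (hTS hs)
      rw [← hK'] at h2
      rw [hT, Finset.mem_filter] at hs
      omega
    · intro s hs
      rw [hT, Finset.mem_sdiff, Finset.mem_filter] at hs
      have h2 := hsep.card_nbrs_deleteEdges_sep (f := f) hgB hs.1
      have h3 := hmaj s hs.1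
      rw [← hK] at h2
      have h4 : ¬ (G.nbrs A s).card ≤ (G.nbrs B s).card := fun h => hs.2 ⟨hs.1, h⟩
      omega
    · intro s hs a ha haF hadj
      rw [Finset.mem_union, not_or] at haF
      exact hsep.deleteEdges_adj_of_notMem_image hgB (hTS hs) ha haF.1 hadj
    · intro s hs b hb hbF hadj
      rw [Finset.mem_union, not_or] at hbF
      rw [hK']
      exact hsep.symm.deleteEdges_adj_of_notMem_image hfA (Finset.mem_sdiff.1 hs).1 hb hbF.2
        hadj
    · exact hsep.card_inter_image_le hgB
    · rw [Finset.union_comm]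
      exact hsep.symm.card_inter_image_le hfA
  obtain ⟨c₀, hc₀, hdis₀⟩ := hsplit.exists_cycles ℓ 0 K _ hrem (by omega)
  have hle : K ≤ G := deleteEdges_le _
  have hes : ∀ i, ((c₀ i).2.mapLe hle).edgeSet = (c₀ i).2.edgeSet := by
    intro i
    ext e
    rw [Walk.mem_edgeSet, Walk.mem_edgeSet, Walk.edges_mapLe_eq_edges]
  obtain ⟨c, hc, hdis, hM⟩ : ∃ c : Fin ℓ → Σ a, G.Walk a a, (∀ i, (c i).2.IsHamiltonianCycle) ∧
      (∀ i j, i ≠ j → Disjoint (c i).2.edgeSet (c j).2.edgeSet) ∧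
      ∀ e ∈ matchingEdges S f g, e ∉ ⋃ i, (c i).2.edgeSet := by
    refine ⟨fun i => ⟨(c₀ i).1, (c₀ i).2.mapLe hle⟩, fun i => ?_, fun i j hij => ?_,
      fun e he he' => ?_⟩
    · exact (hc₀ i).map (f := Hom.ofLE hle) Function.bijective_id
    · rw [hes, hes]
      exact hdis₀ i j hij
    · obtain ⟨i, hi⟩ := Set.mem_iUnion.1 he'
      rw [hes] at hi
      have := (c₀ i).2.edges_subset_edgeSet hi
      rw [hK, edgeSet_deleteEdges] at this
      exact this.2 he
  refine ⟨c, hc, hdis, ?_⟩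
  have hloss := card_nbrs_le_deleteEdges_iUnion_add c hc
  rw [Fintype.card_fin] at hloss
  have hfH : ∀ s ∈ S, f s ∈ A ∧ (G.deleteEdges (⋃ i, (c i).2.edgeSet)).Adj s (f s) := fun s hs =>
    ⟨hfA s hs, by rw [deleteEdges_adj]; exact ⟨(hf' s hs).2, hM _ ⟨s, hs, .inl rfl⟩⟩⟩
  have hgH : ∀ s ∈ S, g s ∈ B ∧ (G.deleteEdges (⋃ i, (c i).2.edgeSet)).Adj s (g s) := fun s hs =>
    ⟨hgB s hs, by rw [deleteEdges_adj]; exact ⟨(hg' s hs).2, hM _ ⟨s, hs, .inr rfl⟩⟩⟩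
  have hsepH := hsep.anti (deleteEdges_le (G := G) (⋃ i, (c i).2.edgeSet))
  generalize G.deleteEdges (⋃ i, (c i).2.edgeSet) = H at *
  have hle' := hsepH.vertexConnectivity_le
  refine le_antisymm (hk ▸ hle') ?_
  obtain ⟨R, P, Q, hR, hRPQ⟩ := exists_isSeparation_of_lt (G := H) (by omega)
  rw [← hk, ← hR]
  refine hsepH.card_le_of_matching (ℓ := ℓ) (x := x) (y := y) rfl ?_ (by omega) (by omega) ?_
    (by omega) (by omega) ?_ hf hfH hg hgH hRPQ
  · intro a ha
    have := hA' a ha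
    have := hloss A a
    omega
  · intro a ha
    have := hB' a ha
    have := hloss B a
    omega
  · intro s hs
    have := hd s
    have := hloss Finset.univ s
    omega

end SimpleGraph

theorem theorem1p7 {V : Type*} [Fintype V] [DecidableEq V]
    (G : SimpleGraph V) [DecidableRel G.Adj] (ℓ : ℕ) (hℓ : 1 ≤ ℓ)
    (hn : max (2 * (G.vertexConnectivity : ℤ) * ℓ + G.vertexConnectivity - 2 * ℓ + 1)
        (6 * (G.vertexConnectivity : ℤ) + 8 * ℓ - 4
          - 2 * ⌈((G.vertexConnectivity : ℚ) - 2) / (G.vertexConnectivity : ℚ)⌉)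
      ≤ (Fintype.card V : ℤ))
    (hδ : (Fintype.card V : ℚ) / 2 ≤ (G.minDegree : ℚ)) :
    ∃ (a : Fin ℓ → V) (H : ∀ i : Fin ℓ, G.Walk (a i) (a i)),
      (∀ i, (H i).IsHamiltonianCycle) ∧
      (∀ i j, i ≠ j → Disjoint (H i).edgeSet (H j).edgeSet) ∧
      (G.deleteEdges (⋃ i, (H i).edgeSet)).vertexConnectivity = G.vertexConnectivity := by
  -- With this bound the second term of the maximum gives `n ≥ 6κ + 8ℓ - 6`, hence `δ ≥ 3κ + 4ℓ -
  -- 3`. At `κ = 0` the quotient is `0` by convention.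
  have hceil : ⌈((G.vertexConnectivity : ℚ) - 2) / (G.vertexConnectivity : ℚ)⌉ ≤ 1 := by
    rw [Int.ceil_le]
    push_cast
    exact div_le_one_of_le₀ (by linarith) (by positivity)
  have hn' := (le_max_right _ _).trans hn
  have hd : Fintype.card V ≤ 2 * G.minDegree := by
    rw [div_le_iff₀ two_pos] at hδ
    rw [mul_comm]
    exact_mod_cast hδ
  have hdeg : ∀ v, G.minDegree ≤ (G.nbrs Finset.univ v).card := by
    intro v
    refine (G.minDegree_le_degree v).trans (Finset.card_le_card fun w hw => ?_)
    rw [SimpleGraph.mem_neighborFinset] at hw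
    exact SimpleGraph.mem_nbrs.2 ⟨Finset.mem_univ w, hw⟩
  obtain ⟨S, A, B, hS, hsep⟩ := SimpleGraph.exists_isSeparation_of_lt (G := G) (by omega)
  obtain ⟨c, h1, h2, h3⟩ := SimpleGraph.exists_hamiltonianCycles_vertexConnectivity_eq hsep hS
    hdeg hd (by omega) hℓ
  exact ⟨fun i => (c i).1, fun i => (c i).2, h1, h2, h3⟩
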